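/- Let $d,d'\ge 1$ be integers. A density matrix is a positive semidefinite complex matrix of trace one. Fix a unitary $U$ on $\mathbb{C}^d\otimes\mathbb{C}^{d'}$ and, for a $d'\times d'$ density matrix $\beta$, let $\Phi^\beta$ be the quantum channel on $\mathcal{M}_d(\mathbb{C})$ given by $\Phi^\beta(X)=\mathrm{Tr}_{\mathbb{C}^{d'}}[U(X\otimes\beta)U^*]$, where $\mathrm{Tr}_{\mathbb{C}^{d'}}$ is the partial trace over the second tensor factor. An invariant state of a channel $\Phi$ is a $d\times d$ density matrix $\rho$ with $\Phi(\rho)=\rho$. Let $(\beta_n)_{n\ge1}$ be a sequence of independent, identically distributed random $d'\times d'$ density matrices, and let $\beta$ denote a random matrix with their common law. Assume that, with non-zero probability, $\Phi^{\beta}$ has a unique invariant state. Then $\mathbb{E}[\beta]$ is a density matrix, the deterministic channel $\Phi^{\mathbb{E}[\beta]}$ has a unique invariant state $\theta$, and almost surely, for all $d\times d$ density matrices $\rho_0$ simultaneously, $$\lim_{N\to\infty}\frac1N\sum_{n=1}^N\big[\Phi^{\beta_n}\circ\cdots\circ\Phi^{\beta_1}\big](\rho_0)=\theta .$$ In particular,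 if $\mathbb{E}[\beta]=I_{d'}/d'$, then $\theta=I_d/d$. -/

import Mathlib

open MeasureTheory ProbabilityTheory Filter Topology
open scoped Kronecker ComplexOrder Matrix

/-- The product (equivalently, Borel) σ-algebra on complex `m × n` matrices. -/
noncomputable instance matrixMeasurableSpace (m n : Type*) : MeasurableSpace (Matrix m n ℂ) :=
  inferInstanceAs (MeasurableSpace (m → n → ℂ))

/-- Density matrices (states): positive semidefinite matrices of trace one. -/
def IsDensityMatrix {d : ℕ} (ρ : Matrix (Fin d) (Fin d) ℂ) : Prop :=
  ρ.PosSemidef ∧ ρ.trace = 1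

/-- The partial trace over the second factor `ℂ^d'` of `ℂ^d ⊗ ℂ^d'`. -/
def partialTraceEnv {d d' : ℕ} :
    Matrix (Fin d × Fin d') (Fin d × Fin d') ℂ →ₗ[ℂ] Matrix (Fin d) (Fin d) ℂ where
  toFun A := Matrix.of fun i j => ∑ k, A (i, k) (j, k)
  map_add' A B := by
    ext i j
    simp [Finset.sum_add_distrib]
  map_smul' c A := by
    ext i j
    simp [Finset.mul_sum]

/-- The map `Φ^{U,β} : X ↦ Tr_env [U (X ⊗ β) U*]` induced on the system `ℂ^d` by the interaction
unitary `U` on `ℂ^d ⊗ ℂ^d'` and the environment matrix `β`. -/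
def interactionChannel {d d' : ℕ} (U : Matrix.unitaryGroup (Fin d × Fin d') ℂ)
    (β : Matrix (Fin d') (Fin d') ℂ) :
    Matrix (Fin d) (Fin d) ℂ →ₗ[ℂ] Matrix (Fin d) (Fin d) ℂ where
  toFun X := partialTraceEnv
    ((U : Matrix (Fin d × Fin d') (Fin d × Fin d') ℂ) * (X ⊗ₖ β) *
      (U : Matrix (Fin d × Fin d') (Fin d × Fin d') ℂ)ᴴ)
  map_add' X Y := by
    rw [Matrix.add_kronecker, Matrix.mul_add, Matrix.add_mul, map_add]
  map_smul' c X := by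
    rw [Matrix.smul_kronecker, Matrix.mul_smul, Matrix.smul_mul, map_smul, RingHom.id_apply]

/-- `ρ` is an invariant state of `Φ`: a density matrix fixed by `Φ`. -/
def IsInvariantState {d : ℕ}
    (Φ : Matrix (Fin d) (Fin d) ℂ →ₗ[ℂ] Matrix (Fin d) (Fin d) ℂ)
    (ρ : Matrix (Fin d) (Fin d) ℂ) : Prop :=
  IsDensityMatrix ρ ∧ Φ ρ = ρ

/-- The state after `n` interactions, with environment states `β 0, β 1, …, β (n - 1)` used in this
order: `(Φ^{U,β (n-1)} ∘ ⋯ ∘ Φ^{U,β 0}) ρ₀`. -/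
def iteratedState {d d' : ℕ} (U : Matrix.unitaryGroup (Fin d × Fin d') ℂ)
    (β : ℕ → Matrix (Fin d') (Fin d') ℂ) (ρ₀ : Matrix (Fin d) (Fin d) ℂ) :
    ℕ → Matrix (Fin d) (Fin d) ℂ
  | 0 => ρ₀
  | n + 1 => interactionChannel U (β n) (iteratedState U β ρ₀ n)

/-- The Cesàro mean `(1 / N) ∑_{n = 1}^{N} ρ_n` of the iterated states. -/
noncomputable def cesaroState {d d' : ℕ} (U : Matrix.unitaryGroup (Fin d × Fin d') ℂ)
    (β : ℕ → Matrix (Fin d') (Fin d') ℂ) (ρ₀ : Matrix (Fin d) (Fin d) ℂ) (N : ℕ) :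
    Matrix (Fin d) (Fin d) ℂ :=
  (1 / (N : ℂ)) • ∑ n ∈ Finset.Icc 1 N, iteratedState U β ρ₀ n

/-- The entrywise expectation of a random matrix. -/
noncomputable def expectedMatrix {Ω : Type*} [MeasurableSpace Ω] {d' : ℕ} (P : Measure Ω)
    (β : Ω → Matrix (Fin d') (Fin d') ℂ) : Matrix (Fin d') (Fin d') ℂ :=
  Matrix.of fun i j => ∫ ω, β ω i j ∂P

/-! Write `γ` for the mean environment state. Since `Φ^β` is linear in `β`, the mean of the random
channel is `Φ^γ`. There are two halves.

Uniqueness for `Φ^γ`. Two distinct invariant states have a difference `A - B` with orthogonal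
supports `p`, `q`, and `Φ^γ` preserves the faces cut out by `p` and by `q`. Preservation is detected
by one scalar each, `tr((1 - p) Φ A) = 0` and `tr((1 - q) Φ B) = 0`
(`IsPositiveTracePreserving.exists_tests_of_ne`). These scalars are linear in `β` and nonnegative on
states, so if they vanish at the mean they vanish almost surely. Then almost every `Φ^β` preserves
two orthogonal faces, each of which contains an invariant state by averaging and compactness,
contrary to uniqueness with positive probability (`expectedMatrix_eq_of_isInvariantState`).

Convergence. Write `ρ_{n+1} = Φ^γ(ρ_n) + D_n`. As `β_n` is independent of `ρ_n`, the `D_n` are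
bounded martingale differences, hence entrywise orthogonal, and a strong law makes their averages
vanish almost surely (`ae_tendsto_average_of_orthogonal`). The Cesàro means of `ρ_n` are then
asymptotically fixed by `Φ^γ`, so by compactness they converge to its only invariant state. Because
`D_n` is linear in `ρ_0`, finitely many initial matrices suffice for one null set. -/

/-! ### Positive semidefinite matrices and traces of products. -/

theorem Matrix.PosSemidef.exists_conjTranspose_mul_self {n : Type*} [Fintype n]
    {X : Matrix n n ℂ} (hX : X.PosSemidef) : ∃ B : Matrix n n ℂ, X = Bᴴ * B := by
  classical
  open scoped MatrixOrder in
  obtain ⟨B, hB⟩ := CStarAlgebra.nonneg_iff_eq_star_mul_self.mp hX.nonneg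
  exact ⟨B, hB⟩

theorem Matrix.PosSemidef.norm_apply_le_trace {n : Type*} [Fintype n]
    {X : Matrix n n ℂ} (hX : X.PosSemidef) (i j : n) : ‖X i j‖ ≤ X.trace.re := by
  obtain ⟨B, rfl⟩ := hX.exists_conjTranspose_mul_self
  have hd : ∀ i, ((Bᴴ * B) i i).re = ∑ k, ‖B k i‖ ^ 2 := by
    intro i
    simp only [Matrix.mul_apply, Matrix.conjTranspose_apply, Complex.re_sum]
    refine Finset.sum_congr rfl fun k _ => ?_
    rw [RCLike.star_def, Complex.conj_mul', ← Complex.ofReal_pow, Complex.ofReal_re]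
  have hle : ∀ i, ∑ k, ‖B k i‖ ^ 2 ≤ (Bᴴ * B).trace.re := by
    intro i
    rw [Matrix.trace, Complex.re_sum, ← hd]
    refine Finset.single_le_sum (f := fun i => ((Bᴴ * B).diag i).re) (fun k _ => ?_)
      (Finset.mem_univ i)
    simp only [Matrix.diag_apply, hd]
    positivity
  have h1 : ‖(Bᴴ * B) i j‖ ≤ ∑ k, ‖B k i‖ * ‖B k j‖ := by
    rw [Matrix.mul_apply]
    refine (norm_sum_le _ _).trans (Finset.sum_le_sum fun k _ => ?_)
    simp
  have h2 : ∑ k, ‖B k i‖ * ‖B k j‖ ≤ ∑ k, (‖B k i‖ ^ 2 + ‖B k j‖ ^ 2) / 2 :=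
    Finset.sum_le_sum fun k _ => by nlinarith [sq_nonneg (‖B k i‖ - ‖B k j‖)]
  rw [← Finset.sum_div, Finset.sum_add_distrib] at h2
  linarith [hle i, hle j]

theorem Matrix.PosSemidef.trace_mul_nonneg {n : Type*} [Fintype n]
    {X Y : Matrix n n ℂ} (hX : X.PosSemidef) (hY : Y.PosSemidef) : 0 ≤ (X * Y).trace := by
  obtain ⟨B, rfl⟩ := hY.exists_conjTranspose_mul_self
  rw [← Matrix.mul_assoc, Matrix.trace_mul_comm, ← Matrix.mul_assoc]
  exact (hX.mul_mul_conjTranspose_same B).trace_nonneg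

theorem Matrix.PosSemidef.mul_eq_zero_of_trace_mul_eq_zero {n : Type*} [Fintype n]
    {X Y : Matrix n n ℂ} (hX : X.PosSemidef) (hY : Y.PosSemidef) (h : (X * Y).trace = 0) :
    X * Y = 0 := by
  obtain ⟨A, rfl⟩ := hX.exists_conjTranspose_mul_self
  obtain ⟨B, rfl⟩ := hY.exists_conjTranspose_mul_self
  have h1 : ((A * Bᴴ) * (A * Bᴴ)ᴴ).trace = 0 := by
    rw [← h, Matrix.conjTranspose_mul, Matrix.conjTranspose_conjTranspose,
      Matrix.mul_assoc Aᴴ, Matrix.trace_mul_comm Aᴴ]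
    simp only [Matrix.mul_assoc]
  have h2 : A * Bᴴ = 0 := Matrix.trace_mul_conjTranspose_self_eq_zero_iff.mp h1
  rw [Matrix.mul_assoc, ← Matrix.mul_assoc A, h2]
  simp

theorem Matrix.isClosed_setOf_posSemidef {n : Type*} [Fintype n] :
    IsClosed {M : Matrix n n ℂ | M.PosSemidef} := by
  simp only [Matrix.posSemidef_iff_dotProduct_mulVec, Set.ofPred_and, Set.ofPred_forall]
  refine IsClosed.inter (isClosed_eq (by fun_prop) continuous_id) (isClosed_iInter fun x => ?_)
  exact isClosed_le continuous_const (by fun_prop)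

/-! ### Spectral calculus, support projections, Jordan decomposition. -/

/-- Real functional calculus of a Hermitian matrix, as an assignment on functions of the index
of the eigenvalue. -/
theorem Matrix.IsHermitian.exists_diagonal_calculus {n : Type*} [Fintype n] [DecidableEq n]
    {X : Matrix n n ℂ} (hX : X.IsHermitian) :
    ∃ T : (n → ℝ) →ₐ[ℝ] Matrix n n ℂ, T hX.eigenvalues = X ∧ ∀ f, 0 ≤ f → (T f).PosSemidef := by
  let V : Matrix n n ℂ := hX.eigenvectorUnitary
  have hV : Vᴴ * V = 1 := Unitary.coe_star_mul_self hX.eigenvectorUnitary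
  have hV' : V * Vᴴ = 1 := Unitary.coe_mul_star_self hX.eigenvectorUnitary
  let T : (n → ℝ) →ₐ[ℝ] Matrix n n ℂ := AlgHom.ofLinearMap
    { toFun := fun f => V * Matrix.diagonal (fun i => (f i : ℂ)) * Vᴴ
      map_add' := fun f g => by
        rw [← Matrix.add_mul, ← Matrix.mul_add, Matrix.diagonal_add]
        simp
      map_smul' := fun c f => by
        have : Matrix.diagonal (fun i => ((c • f) i : ℂ))
            = (c : ℂ) • Matrix.diagonal (fun i => (f i : ℂ)) := by
          rw [← Matrix.diagonal_smul]; congr 1; ext i; simp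
        rw [this, Matrix.mul_smul, Matrix.smul_mul]
        rfl }
    (by
      have : (Matrix.diagonal fun _ : n => (1 : ℂ)) = 1 := Matrix.diagonal_one
      simp [this, hV'])
    (fun f g => by
      have : Matrix.diagonal (fun i => ((f * g) i : ℂ))
          = Matrix.diagonal (fun i => (f i : ℂ)) * Matrix.diagonal (fun i => (g i : ℂ)) := by
        rw [Matrix.diagonal_mul_diagonal]; simp
      simp only [LinearMap.coe_mk, AddHom.coe_mk, this]
      calc _ = V * Matrix.diagonal (fun i => (f i : ℂ)) * 1 *
            Matrix.diagonal (fun i => (g i : ℂ)) * Vᴴ := by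
            rw [Matrix.mul_one]; simp only [Matrix.mul_assoc]
        _ = _ := by rw [← hV]; simp only [Matrix.mul_assoc])
  refine ⟨T, ?_, fun f hf => ?_⟩
  · conv_rhs => rw [hX.spectral_theorem]
    rfl
  · exact (Matrix.PosSemidef.diagonal (d := fun i => (f i : ℂ))
      (fun i => by simpa using hf i)).mul_mul_conjTranspose_same V

theorem Matrix.PosSemidef.exists_le_smul_one {n : Type*} [Fintype n] [DecidableEq n]
    {X : Matrix n n ℂ} (hX : X.PosSemidef) :
    ∃ c : ℝ, 0 ≤ c ∧ (c • (1 : Matrix n n ℂ) - X).PosSemidef := by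
  obtain ⟨T, hT, hpos⟩ := hX.isHermitian.exists_diagonal_calculus
  refine ⟨∑ i, |hX.isHermitian.eigenvalues i|, by positivity, ?_⟩
  have := hpos ((∑ i, |hX.isHermitian.eigenvalues i|) • 1 - hX.isHermitian.eigenvalues)
    (fun i => by
      have h1 := Finset.single_le_sum (f := fun i => |hX.isHermitian.eigenvalues i|)
        (fun _ _ => abs_nonneg _) (Finset.mem_univ i)
      have h2 := le_abs_self (hX.isHermitian.eigenvalues i)
      simp only [Pi.zero_apply, Pi.sub_apply, Pi.smul_apply, Pi.one_apply, smul_eq_mul, mul_one]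
      linarith)
  rwa [map_sub, map_smul, map_one, hT] at this

/-- `p` is an orthogonal projection onto the support of the positive semidefinite matrix `A`. -/
structure IsSupportProjection {n : Type*} [Fintype n] [DecidableEq n] (p A : Matrix n n ℂ) :
    Prop where
  posSemidef : p.PosSemidef
  one_sub : (1 - p).PosSemidef
  mul_self : p * p = p
  mul_eq : p * A = A
  le_smul : ∃ c : ℝ, 0 ≤ c ∧ (c • A - p).PosSemidef

/-- Jordan decomposition of a Hermitian matrix, with the support projections of its parts. -/
theorem Matrix.IsHermitian.exists_jordan_decomposition {n : Type*} [Fintype n] [DecidableEq n]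
    {X : Matrix n n ℂ} (hX : X.IsHermitian) :
    ∃ A B p q : Matrix n n ℂ, X = A - B ∧ A.PosSemidef ∧ B.PosSemidef ∧
      IsSupportProjection p A ∧ IsSupportProjection q B ∧ p * q = 0 ∧ p * B = 0 ∧ q * A = 0 := by
  obtain ⟨T, hT, hpos⟩ := hX.exists_diagonal_calculus
  set l := hX.eigenvalues
  have key : ∀ m : n → ℝ, IsSupportProjection (T fun i => if 0 < m i then 1 else 0)
      (T fun i => max (m i) 0) := by
    intro m
    -- The constant dominates the inverse of every positive `m i`; a zero eigenvalue contributes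
    -- `0⁻¹ = 0`, which is harmless.
    refine ⟨hpos _ fun i => ?_, ?_, ?_, ?_, ∑ i, |m i|⁻¹, by positivity, ?_⟩
    · change (0 : ℝ) ≤ if 0 < m i then 1 else 0
      split_ifs <;> simp
    · rw [← map_one T, ← map_sub]
      refine hpos _ fun i => ?_
      simp only [Pi.sub_apply, Pi.one_apply]; split_ifs <;> simp
    · rw [← map_mul]; congr 1; ext i; simp
    · rw [← map_mul]; congr 1; ext i
      simp only [Pi.mul_apply]
      split_ifs with h
      · simp
      · simp [max_eq_right (not_lt.mp h)]
    · rw [← map_smul, ← map_sub]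
      refine hpos _ fun i => ?_
      have h1 := Finset.single_le_sum (f := fun i => |m i|⁻¹)
        (fun _ _ => by positivity) (Finset.mem_univ i)
      simp only [Pi.zero_apply, Pi.sub_apply, Pi.smul_apply, smul_eq_mul]
      split_ifs with h
      · have : |m i|⁻¹ * max (m i) 0 = 1 := by
          rw [max_eq_left h.le, abs_of_pos h, inv_mul_cancel₀ h.ne']
        have h3 := mul_le_mul_of_nonneg_right h1 (le_max_right (m i) 0)
        linarith
      · simp only [sub_zero]; positivity
  refine ⟨_, _, _, _, ?_, hpos _ fun i => le_max_right _ _, hpos _ fun i => le_max_right _ _,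
    key l, key (-l), ?_, ?_, ?_⟩
  · rw [← map_sub, ← hT]; congr 1; ext i
    rcases le_total (l i) 0 with h | h <;> simp [h]
  all_goals
    rw [← map_mul, ← map_zero T]; congr 1; ext i
    rcases lt_trichotomy (l i) 0 with h | h | h <;> simp [h, h.le, h.not_gt]

/-! ### Positive trace-preserving maps and the faces they preserve. -/

/-- Positive trace-preserving linear maps on matrices. -/
structure IsPositiveTracePreserving {n : Type*} [Fintype n]
    (Φ : Matrix n n ℂ →ₗ[ℂ] Matrix n n ℂ) : Prop where
  posSemidef : ∀ X, X.PosSemidef → (Φ X).PosSemidef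
  trace : ∀ X, (Φ X).trace = X.trace

/-- Pairing the fixed point `A - B` with `p` gives `tr(p Φ A) - tr(p Φ B) = tr A = tr(Φ A)`. Hence
`tr((1 - p) Φ A) = -tr(p Φ B)`, where the left side is nonnegative and the right side nonpositive.
-/
theorem IsPositiveTracePreserving.trace_support_eq_zero {n : Type*} [Fintype n] [DecidableEq n]
    {Φ : Matrix n n ℂ →ₗ[ℂ] Matrix n n ℂ} (hΦ : IsPositiveTracePreserving Φ)
    {A B p : Matrix n n ℂ} (hA : A.PosSemidef) (hB : B.PosSemidef)
    (hp : IsSupportProjection p A) (hpB : p * B = 0) (hfix : Φ (A - B) = A - B) :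
    ((1 - p) * Φ A).trace = 0 := by
  have h1 := hp.one_sub.trace_mul_nonneg (hΦ.posSemidef A hA)
  have h2 := hp.posSemidef.trace_mul_nonneg (hΦ.posSemidef B hB)
  have h3 : (p * Φ A).trace - (p * Φ B).trace = A.trace := by
    rw [← Matrix.trace_sub, ← Matrix.mul_sub, ← map_sub, hfix, Matrix.mul_sub, hp.mul_eq, hpB,
      sub_zero]
  have h4 : ((1 - p) * Φ A).trace = A.trace - (p * Φ A).trace := by
    rw [Matrix.sub_mul, Matrix.one_mul, Matrix.trace_sub, hΦ.trace]
  refine le_antisymm ?_ h1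
  have : ((1 - p) * Φ A).trace = -(p * Φ B).trace := by rw [h4, ← h3]; ring
  rw [this]
  exact neg_nonpos.mpr h2

/-- A single scalar condition at `A` controls the whole face: compressing `Y ≤ c • 1` by `p` gives
`Y ≤ c • p ≤ (c * C) • A`, so positivity of `Φ` passes the vanishing trace from `A` to `Y`. -/
theorem IsPositiveTracePreserving.support_mul_eq {n : Type*} [Fintype n] [DecidableEq n]
    {Φ : Matrix n n ℂ →ₗ[ℂ] Matrix n n ℂ} (hΦ : IsPositiveTracePreserving Φ)
    {A p Y : Matrix n n ℂ} (hp : IsSupportProjection p A)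
    (h0 : ((1 - p) * Φ A).trace = 0) (hY : Y.PosSemidef) (hpY : p * Y = Y) :
    p * Φ Y = Φ Y := by
  obtain ⟨c, hc, hcY⟩ := hY.exists_le_smul_one
  obtain ⟨C, hC, hCA⟩ := hp.le_smul
  have hYp : Y * p = Y := by
    have := congrArg Matrix.conjTranspose hpY
    rwa [Matrix.conjTranspose_mul, hY.isHermitian.eq, hp.posSemidef.isHermitian.eq] at this
  have h1 : (c • p - Y).PosSemidef := by
    have := hcY.mul_mul_conjTranspose_same p
    rw [hp.posSemidef.isHermitian.eq, Matrix.mul_sub, Matrix.sub_mul, hpY, hYp, Matrix.mul_smul,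
      Matrix.smul_mul, Matrix.mul_one, hp.mul_self] at this
    exact this
  have h2 : ((c * C) • A - Y).PosSemidef := by
    have := (hCA.smul hc).add h1
    rwa [smul_sub, smul_smul, sub_add_sub_cancel] at this
  have h3 := hp.one_sub.trace_mul_nonneg (hΦ.posSemidef _ h2)
  have h4 : ((1 - p) * Φ ((c * C) • A - Y)).trace = - ((1 - p) * Φ Y).trace := by
    rw [map_sub, LinearMap.map_smul_of_tower, Matrix.mul_sub, Matrix.mul_smul, Matrix.trace_sub,
      Matrix.trace_smul, h0, smul_zero, zero_sub]
  rw [h4, neg_nonneg] at h3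
  have h5 := hp.one_sub.mul_eq_zero_of_trace_mul_eq_zero (hΦ.posSemidef _ hY)
    (le_antisymm h3 (hp.one_sub.trace_mul_nonneg (hΦ.posSemidef _ hY)))
  rw [Matrix.sub_mul, Matrix.one_mul, sub_eq_zero] at h5
  exact h5.symm

/-! ### Cesàro means and their cluster points. -/

theorem Matrix.tendsto_zero_of_norm_apply_le {n : Type*} {f : ℕ → Matrix n n ℂ} {C : ℝ}
    (hf : ∀ k i j, ‖f k i j‖ ≤ C) :
    Tendsto (fun N : ℕ => (1 / (N : ℂ)) • f N) atTop (𝓝 0) := by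
  refine tendsto_pi_nhds.mpr fun i => tendsto_pi_nhds.mpr fun j => ?_
  refine squeeze_zero_norm (a := fun N : ℕ => C * (1 / (N : ℝ))) (fun N => ?_) ?_
  · rw [Matrix.smul_apply, norm_smul, norm_div, norm_one, Complex.norm_natCast, mul_comm]
    exact mul_le_mul_of_nonneg_right (hf N i j) (by positivity)
  · simpa using tendsto_one_div_atTop_nhds_zero_nat.const_mul C

/-- Cesàro means of a bounded sequence that is a linear orbit up to negligible errors are
asymptotically invariant. -/
theorem tendsto_map_cesaro_sub {n : Type*} [Fintype n]
    (Φ : Matrix n n ℂ →ₗ[ℂ] Matrix n n ℂ) {r : ℕ → Matrix n n ℂ} {C : ℝ}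
    (hr : ∀ k i j, ‖r k i j‖ ≤ C)
    (hD : Tendsto (fun N : ℕ => (1 / (N : ℂ)) • ∑ k ∈ Finset.Icc 1 N, (r (k + 1) - Φ (r k)))
      atTop (𝓝 0)) :
    Tendsto (fun N : ℕ => Φ ((1 / (N : ℂ)) • ∑ k ∈ Finset.Icc 1 N, r k) -
      (1 / (N : ℂ)) • ∑ k ∈ Finset.Icc 1 N, r k) atTop (𝓝 0) := by
  have h1 : Tendsto (fun N : ℕ => (1 / (N : ℂ)) • (r (N + 1) - r 1)) atTop (𝓝 0) :=
    Matrix.tendsto_zero_of_norm_apply_le (f := fun N => r (N + 1) - r 1) (C := C + C)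
      fun k i j => (norm_sub_le _ _).trans (add_le_add (hr _ _ _) (hr _ _ _))
  have h2 := h1.sub hD
  rw [sub_zero] at h2
  refine h2.congr fun N => ?_
  rw [map_smul, ← smul_sub, ← smul_sub, map_sum]
  congr 1
  have htel : ∑ k ∈ Finset.Icc 1 N, (r (k + 1) - r k) = r (N + 1) - r 1 := by
    rw [← Finset.Ico_add_one_right_eq_Icc, Finset.sum_Ico_sub r (by lia)]
  rw [← htel, ← Finset.sum_sub_distrib, ← Finset.sum_sub_distrib]
  exact Finset.sum_congr rfl fun k _ => by abel

theorem LinearMap.apply_eq_of_mapClusterPt {n ι : Type*} [Fintype n]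
    (Φ : Matrix n n ℂ →ₗ[ℂ] Matrix n n ℂ) {l : Filter ι} {S : ι → Matrix n n ℂ}
    {x : Matrix n n ℂ} (hx : MapClusterPt x l S)
    (hS : Tendsto (fun i => Φ (S i) - S i) l (𝓝 0)) : Φ x = x := by
  have hc : Continuous fun X : Matrix n n ℂ => Φ X - X :=
    Φ.continuous_of_finiteDimensional.sub continuous_id
  have h1 : MapClusterPt (Φ x - x) l (fun i => Φ (S i) - S i) :=
    hx.continuousAt_comp hc.continuousAt
  have h2 : ClusterPt (Φ x - x) (𝓝 0) := h1.clusterPt.mono hS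
  exact sub_eq_zero.mp (t2_iff_nhds.mp inferInstance h2)

/-! ### Compactness of the state space and invariant states. -/

theorem isClosed_setOf_isDensityMatrix {d : ℕ} :
    IsClosed {ρ : Matrix (Fin d) (Fin d) ℂ | IsDensityMatrix ρ} :=
  Matrix.isClosed_setOf_posSemidef.inter (isClosed_eq (by fun_prop) continuous_const)

theorem IsDensityMatrix.norm_apply_le_one {d : ℕ} {ρ : Matrix (Fin d) (Fin d) ℂ}
    (h : IsDensityMatrix ρ) (i j : Fin d) : ‖ρ i j‖ ≤ 1 := by
  simpa [h.2] using h.1.norm_apply_le_trace i j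

theorem isCompact_setOf_isDensityMatrix {d : ℕ} :
    IsCompact {ρ : Matrix (Fin d) (Fin d) ℂ | IsDensityMatrix ρ} := by
  have hK : IsCompact (Set.univ.pi fun _ : Fin d => Set.univ.pi fun _ : Fin d =>
      Metric.closedBall (0 : ℂ) 1) :=
    isCompact_univ_pi fun _ => isCompact_univ_pi fun _ => isCompact_closedBall _ _
  refine IsCompact.of_isClosed_subset hK isClosed_setOf_isDensityMatrix fun ρ hρ => ?_
  exact fun i _ j _ => by simpa using IsDensityMatrix.norm_apply_le_one hρ i j

theorem IsDensityMatrix.cesaro {d : ℕ} {r : ℕ → Matrix (Fin d) (Fin d) ℂ}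
    (hr : ∀ k, IsDensityMatrix (r k)) {N : ℕ} (hN : N ≠ 0) :
    IsDensityMatrix ((1 / (N : ℂ)) • ∑ k ∈ Finset.Icc 1 N, r k) := by
  refine ⟨(Matrix.posSemidef_sum _ fun k _ => (hr k).1).smul (by positivity), ?_⟩
  rw [Matrix.trace_smul, Matrix.trace_sum, Finset.sum_congr rfl fun k _ => (hr k).2]
  simp [hN]

theorem IsPositiveTracePreserving.isDensityMatrix {d : ℕ}
    {Φ : Matrix (Fin d) (Fin d) ℂ →ₗ[ℂ] Matrix (Fin d) (Fin d) ℂ}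
    (hΦ : IsPositiveTracePreserving Φ) {ρ : Matrix (Fin d) (Fin d) ℂ} (hρ : IsDensityMatrix ρ) :
    IsDensityMatrix (Φ ρ) :=
  ⟨hΦ.posSemidef _ hρ.1, (hΦ.trace _).trans hρ.2⟩

/-- A positive trace-preserving map has an invariant state in every nonempty face
`{ρ | p ρ = ρ}` that it preserves. -/
theorem IsPositiveTracePreserving.exists_isInvariantState {d : ℕ}
    {Φ : Matrix (Fin d) (Fin d) ℂ →ₗ[ℂ] Matrix (Fin d) (Fin d) ℂ}
    (hΦ : IsPositiveTracePreserving Φ) {p ρ : Matrix (Fin d) (Fin d) ℂ}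
    (hp : ∀ Y : Matrix (Fin d) (Fin d) ℂ, Y.PosSemidef → p * Y = Y → p * Φ Y = Φ Y)
    (hρ : IsDensityMatrix ρ) (hpρ : p * ρ = ρ) :
    ∃ σ, IsInvariantState Φ σ ∧ p * σ = σ := by
  set r : ℕ → Matrix (Fin d) (Fin d) ℂ := fun k => Φ^[k] ρ with hr
  have hsucc : ∀ k, r (k + 1) = Φ (r k) := fun k => Function.iterate_succ_apply' Φ k ρ
  have hK : ∀ k, IsDensityMatrix (r k) ∧ p * r k = r k := by
    intro k
    induction k with
    | zero => exact ⟨hρ, hpρ⟩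
    | succ k ih =>
      rw [hsucc]
      exact ⟨hΦ.isDensityMatrix ih.1, hp _ ih.1.1 ih.2⟩
  set S : ℕ → Matrix (Fin d) (Fin d) ℂ := fun N => (1 / (N : ℂ)) • ∑ k ∈ Finset.Icc 1 N, r k
  have hS : Tendsto (fun N => Φ (S N) - S N) atTop (𝓝 0) :=
    tendsto_map_cesaro_sub Φ (fun k => (hK k).1.norm_apply_le_one) (by simp [hsucc])
  have hcpt : IsCompact {σ : Matrix (Fin d) (Fin d) ℂ | IsDensityMatrix σ ∧ p * σ = σ} :=
    isCompact_setOf_isDensityMatrix.inter_right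
      (isClosed_eq (continuous_const.matrix_mul continuous_id) continuous_id)
  have hmem : ∀ᶠ N in atTop, S N ∈ {σ : Matrix (Fin d) (Fin d) ℂ | IsDensityMatrix σ ∧ p * σ = σ} := by
    filter_upwards [eventually_ne_atTop 0] with N hN
    refine ⟨IsDensityMatrix.cesaro (fun k => (hK k).1) hN, ?_⟩
    rw [Matrix.mul_smul, Matrix.mul_sum, Finset.sum_congr rfl fun k _ => (hK k).2]
  obtain ⟨σ, hσ, hcl⟩ := hcpt.exists_mapClusterPt_of_frequently hmem.frequently
  exact ⟨σ, ⟨hσ.1, Φ.apply_eq_of_mapClusterPt hcl hS⟩, hσ.2⟩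

theorem IsSupportProjection.exists_isDensityMatrix {d : ℕ} {p A : Matrix (Fin d) (Fin d) ℂ}
    (hp : IsSupportProjection p A) (hA : A.PosSemidef) (h0 : A ≠ 0) :
    ∃ ρ, IsDensityMatrix ρ ∧ p * ρ = ρ := by
  have ht : A.trace ≠ 0 := fun h => h0 (hA.trace_eq_zero_iff.mp h)
  refine ⟨A.trace⁻¹ • A, ⟨hA.smul (inv_nonneg_of_nonneg hA.trace_nonneg), ?_⟩, ?_⟩
  · rw [Matrix.trace_smul, smul_eq_mul, inv_mul_cancel₀ ht]
  · rw [Matrix.mul_smul, hp.mul_eq]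

/-- If a positive trace-preserving map leaves two different states invariant, then there are two
nonnegative tests vanishing on it such that every positive trace-preserving map on which they vanish
has more than one invariant state. -/
theorem IsPositiveTracePreserving.exists_tests_of_ne {d : ℕ}
    {Φ : Matrix (Fin d) (Fin d) ℂ →ₗ[ℂ] Matrix (Fin d) (Fin d) ℂ}
    (hΦ : IsPositiveTracePreserving Φ) {θ σ : Matrix (Fin d) (Fin d) ℂ}
    (hθ : IsInvariantState Φ θ) (hσ : IsInvariantState Φ σ) (hne : θ ≠ σ) :
    ∃ A B P Q : Matrix (Fin d) (Fin d) ℂ, A.PosSemidef ∧ B.PosSemidef ∧ P.PosSemidef ∧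
      Q.PosSemidef ∧ (P * Φ A).trace = 0 ∧ (Q * Φ B).trace = 0 ∧
      ∀ Ψ : Matrix (Fin d) (Fin d) ℂ →ₗ[ℂ] Matrix (Fin d) (Fin d) ℂ,
        IsPositiveTracePreserving Ψ → (P * Ψ A).trace = 0 → (Q * Ψ B).trace = 0 →
        ¬ ∃! ρ, IsInvariantState Ψ ρ := by
  obtain ⟨A, B, p, q, hX, hA, hB, hp, hq, hpq, hpB, hqA⟩ :=
    (hθ.1.1.isHermitian.sub hσ.1.1.isHermitian).exists_jordan_decomposition
  have hfix : Φ (A - B) = A - B := by rw [← hX, map_sub, hθ.2, hσ.2]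
  have hfix' : Φ (B - A) = B - A := by rw [← neg_sub, map_neg, hfix]
  have htr : A.trace = B.trace := by
    rw [← sub_eq_zero, ← Matrix.trace_sub, ← hX, Matrix.trace_sub, hθ.1.2, hσ.1.2, sub_self]
  have hAB : ¬ (A = 0 ∧ B = 0) := fun h => hne (sub_eq_zero.mp (by rw [hX, h.1, h.2, sub_zero]))
  have hA0 : A ≠ 0 := fun h => hAB ⟨h, hB.trace_eq_zero_iff.mp (by rw [← htr, h, Matrix.trace_zero])⟩
  have hB0 : B ≠ 0 := fun h => hAB ⟨hA.trace_eq_zero_iff.mp (by rw [htr, h, Matrix.trace_zero]), h⟩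
  refine ⟨A, B, 1 - p, 1 - q, hA, hB, hp.one_sub, hq.one_sub,
    hΦ.trace_support_eq_zero hA hB hp hpB hfix, hΦ.trace_support_eq_zero hB hA hq hqA hfix',
    fun Ψ hΨ h1 h2 huniq => ?_⟩
  obtain ⟨ρ₁, hρ₁, hp₁⟩ := hp.exists_isDensityMatrix hA hA0
  obtain ⟨ρ₂, hρ₂, hp₂⟩ := hq.exists_isDensityMatrix hB hB0
  obtain ⟨τ₁, hτ₁, h1'⟩ :=
    hΨ.exists_isInvariantState (fun Y hY => hΨ.support_mul_eq hp h1 hY) hρ₁ hp₁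
  obtain ⟨τ₂, hτ₂, h2'⟩ :=
    hΨ.exists_isInvariantState (fun Y hY => hΨ.support_mul_eq hq h2 hY) hρ₂ hp₂
  have heq := huniq.unique hτ₁ hτ₂
  -- A state lying in both orthogonal faces satisfies `τ = p τ = p q τ = 0`.
  have h0 : τ₁ = 0 := by rw [← h1', heq, ← h2', ← Matrix.mul_assoc, hpq, Matrix.zero_mul]
  have := hτ₁.1.2
  simp [h0] at this

/-! ### Interaction channels -/

section Channel

variable {d d' : ℕ} (U : Matrix.unitaryGroup (Fin d × Fin d') ℂ)

theorem partialTraceEnv_posSemidef {A : Matrix (Fin d × Fin d') (Fin d × Fin d') ℂ}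
    (hA : A.PosSemidef) : (partialTraceEnv A).PosSemidef := by
  have : partialTraceEnv A = ∑ k, A.submatrix (fun i : Fin d => (i, k)) (fun i => (i, k)) := by
    ext i j
    simp [partialTraceEnv, Matrix.sum_apply]
  rw [this]
  exact Matrix.posSemidef_sum _ fun k _ => hA.submatrix _

theorem trace_partialTraceEnv (A : Matrix (Fin d × Fin d') (Fin d × Fin d') ℂ) :
    (partialTraceEnv A).trace = A.trace := by
  simp [partialTraceEnv, Matrix.trace, Fintype.sum_prod_type]

theorem interactionChannel_posSemidef {β : Matrix (Fin d') (Fin d') ℂ} (hβ : β.PosSemidef)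
    {X : Matrix (Fin d) (Fin d) ℂ} (hX : X.PosSemidef) : (interactionChannel U β X).PosSemidef :=
  partialTraceEnv_posSemidef ((hX.kronecker hβ).mul_mul_conjTranspose_same _)

theorem trace_interactionChannel (β : Matrix (Fin d') (Fin d') ℂ) (X : Matrix (Fin d) (Fin d) ℂ) :
    (interactionChannel U β X).trace = X.trace * β.trace := by
  have hU : (U : Matrix (Fin d × Fin d') (Fin d × Fin d') ℂ)ᴴ * U = 1 :=
    Unitary.coe_star_mul_self U
  change (partialTraceEnv _).trace = _
  rw [trace_partialTraceEnv, Matrix.trace_mul_comm, ← Matrix.mul_assoc, hU, Matrix.one_mul,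
    Matrix.trace_kronecker]

theorem IsDensityMatrix.isPositiveTracePreserving {β : Matrix (Fin d') (Fin d') ℂ}
    (hβ : IsDensityMatrix β) : IsPositiveTracePreserving (interactionChannel U β) :=
  ⟨fun _ hX => interactionChannel_posSemidef U hβ.1 hX, fun X => by
    rw [trace_interactionChannel, hβ.2, mul_one]⟩

/-- The interaction channel applied to a fixed matrix, as a linear map of the environment
matrix. -/
def interactionChannelEnv (X : Matrix (Fin d) (Fin d) ℂ) :
    Matrix (Fin d') (Fin d') ℂ →ₗ[ℂ] Matrix (Fin d) (Fin d) ℂ where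
  toFun β := interactionChannel U β X
  map_add' β γ := by
    change partialTraceEnv _ = partialTraceEnv _ + partialTraceEnv _
    rw [Matrix.kronecker_add, Matrix.mul_add, Matrix.add_mul, map_add]
  map_smul' c β := by
    change partialTraceEnv _ = c • partialTraceEnv _
    rw [Matrix.kronecker_smul, Matrix.mul_smul, Matrix.smul_mul, map_smul]

theorem Matrix.linearMap_apply_eq_sum {m n E : Type*} [Fintype m] [Fintype n] [DecidableEq m]
    [DecidableEq n] [AddCommGroup E] [Module ℂ E] (f : Matrix m n ℂ →ₗ[ℂ] E) (M : Matrix m n ℂ) :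
    f M = ∑ i, ∑ j, M i j • f (Matrix.single i j 1) := by
  conv_lhs => rw [Matrix.matrix_eq_sum_single M]
  simp only [map_sum, ← map_smul, Matrix.smul_single, smul_eq_mul, mul_one]

theorem interactionChannel_apply_eq_sum (β : Matrix (Fin d') (Fin d') ℂ)
    (X : Matrix (Fin d) (Fin d) ℂ) (a b : Fin d) :
    interactionChannel U β X a b =
      ∑ k, ∑ l, β k l * interactionChannel U (Matrix.single k l 1) X a b := by
  change interactionChannelEnv U X β a b = _
  rw [Matrix.linearMap_apply_eq_sum (interactionChannelEnv U X) β]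
  simp only [Matrix.sum_apply, Matrix.smul_apply, smul_eq_mul]
  rfl

theorem interactionChannel_maximallyMixed (hd' : d' ≠ 0) (c : ℂ) :
    interactionChannel U ((1 / (d' : ℂ)) • 1) (c • 1) = c • 1 := by
  have hU : (U : Matrix (Fin d × Fin d') (Fin d × Fin d') ℂ) *
      (U : Matrix (Fin d × Fin d') (Fin d × Fin d') ℂ)ᴴ = 1 := Unitary.coe_mul_star_self U
  change partialTraceEnv _ = _
  rw [Matrix.smul_kronecker, Matrix.kronecker_smul, Matrix.one_kronecker_one]
  simp only [Matrix.mul_smul, Matrix.smul_mul, Matrix.mul_one, hU, map_smul]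
  congr 1
  ext i j
  by_cases h : i = j
  · subst h
    simp [partialTraceEnv, hd']
  · simp [partialTraceEnv, h, Matrix.one_apply]

end Channel

/-! ### A strong law for bounded orthogonal sequences -/

/-- Squares are dense enough: with `m = √N` rounded down, at most `2 * m` terms lie beyond `m ^ 2`,
and they add at most `2 * C / m` to the average. -/
theorem tendsto_average_of_tendsto_average_sq {x : ℕ → ℂ} {C : ℝ} (hb : ∀ n, ‖x n‖ ≤ C)
    (h : Tendsto (fun m : ℕ => ‖∑ n ∈ Finset.range (m ^ 2), x n‖ / (m : ℝ) ^ 2) atTop (𝓝 0)) :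
    Tendsto (fun N : ℕ => (1 / (N : ℂ)) * ∑ n ∈ Finset.range N, x n) atTop (𝓝 0) := by
  have hC : 0 ≤ C := (norm_nonneg _).trans (hb 0)
  have hsqrt : Tendsto Nat.sqrt atTop atTop :=
    tendsto_atTop_mono' _ (f₁ := fun N => Nat.sqrt N) (Eventually.of_forall fun _ => le_rfl)
      (tendsto_atTop.mpr fun b => eventually_atTop.mpr
        ⟨b * b, fun N hN => Nat.le_sqrt.mpr hN⟩)
  have h1 : Tendsto (fun m : ℕ => ‖∑ n ∈ Finset.range (m ^ 2), x n‖ / (m : ℝ) ^ 2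
      + 2 * C * (1 / (m : ℝ))) atTop (𝓝 0) := by
    simpa using h.add (tendsto_one_div_atTop_nhds_zero_nat.const_mul (2 * C))
  refine squeeze_zero_norm' ?_ (h1.comp hsqrt)
  filter_upwards [eventually_ge_atTop 1] with N hN
  have hm : 0 < Nat.sqrt N := Nat.sqrt_pos.mpr hN
  have hle : Nat.sqrt N ^ 2 ≤ N := Nat.sqrt_le' N
  have hlt : N ≤ Nat.sqrt N ^ 2 + 2 * Nat.sqrt N := by
    have := Nat.sqrt_le_add N
    nlinarith
  set m := Nat.sqrt N
  have hsum : ‖∑ n ∈ Finset.range N, x n‖ ≤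
      ‖∑ n ∈ Finset.range (m ^ 2), x n‖ + 2 * m * C := by
    rw [← Finset.sum_range_add_sum_Ico x hle]
    refine (norm_add_le _ _).trans (add_le_add le_rfl ?_)
    refine (norm_sum_le_of_le _ fun n _ => hb n).trans ?_
    rw [Finset.sum_const, Nat.card_Ico, nsmul_eq_mul]
    refine mul_le_mul_of_nonneg_right ?_ hC
    exact_mod_cast (by lia : N - m ^ 2 ≤ 2 * m)
  rw [norm_mul, norm_div, norm_one, Complex.norm_natCast, one_div_mul_eq_div]
  have hm' : (0 : ℝ) < m := by exact_mod_cast hm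
  calc _ ≤ (‖∑ n ∈ Finset.range (m ^ 2), x n‖ + 2 * m * C) / (m : ℝ) ^ 2 := by
        refine div_le_div₀ (by positivity) hsum (by positivity) ?_
        exact_mod_cast hle
    _ = _ := by
        simp only [Function.comp_apply]
        change _ = ‖∑ n ∈ Finset.range (m ^ 2), x n‖ / (m : ℝ) ^ 2 + 2 * C * (1 / (m : ℝ))
        field_simp

section Orthogonal

variable {Ω : Type*} [MeasurableSpace Ω] {P : Measure Ω} [IsProbabilityMeasure P]
  {X : ℕ → Ω → ℂ} {C : ℝ}

/-- Pythagoras in `L²`, by induction: the cross term between the new variable and the previous sum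
integrates to zero. -/
theorem integral_norm_sq_sum_le_of_orthogonal (hm : ∀ n, AEStronglyMeasurable (X n) P)
    (hb : ∀ n, ∀ᵐ ω ∂P, ‖X n ω‖ ≤ C)
    (horth : ∀ i j, i < j → ∫ ω, X j ω * star (X i ω) ∂P = 0) (N : ℕ) :
    ∫ ω, ‖∑ n ∈ Finset.range N, X n ω‖ ^ 2 ∂P ≤ C ^ 2 * N := by
  have hm2 : ∀ N, AEStronglyMeasurable (fun ω => ∑ n ∈ Finset.range N, X n ω) P := fun N =>
    Finset.aestronglyMeasurable_fun_sum _ fun n _ => hm n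
  have hb2 : ∀ N : ℕ, ∀ᵐ ω ∂P, ‖∑ n ∈ Finset.range N, X n ω‖ ≤ N * C := by
    intro N
    filter_upwards [ae_all_iff.mpr hb] with ω hω
    simpa using norm_sum_le_of_le (Finset.range N) fun n _ => hω n
  have hint : ∀ N : ℕ, Integrable (fun ω => ‖∑ n ∈ Finset.range N, X n ω‖ ^ 2) P := by
    intro N
    refine Integrable.of_bound ((hm2 N).norm.pow 2) ((N * C) ^ 2) ?_
    filter_upwards [hb2 N] with ω hω
    rw [norm_pow, norm_norm]
    gcongr
  have hXint : ∀ n : ℕ, Integrable (fun ω => ‖X n ω‖ ^ 2) P := by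
    intro n
    refine Integrable.of_bound ((hm n).norm.pow 2) (C ^ 2) ?_
    filter_upwards [hb n] with ω hω
    rw [norm_pow, norm_norm]
    gcongr
  have hcross : ∀ i j, Integrable (fun ω => X j ω * star (X i ω)) P := by
    intro i j
    refine Integrable.of_bound ((hm j).mul (hm i).star) (C * C) ?_
    filter_upwards [hb i, hb j] with ω hi hj
    rw [norm_mul, norm_star]
    exact mul_le_mul hj hi (norm_nonneg _) ((norm_nonneg _).trans hj)
  induction N with
  | zero => simp
  | succ N ih =>
    have hc : Integrable (fun ω => X N ω * star (∑ n ∈ Finset.range N, X n ω)) P := by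
      simp only [star_sum, Finset.mul_sum]
      exact integrable_finsetSum _ fun n _ => hcross n N
    have hc0 : ∫ ω, X N ω * star (∑ n ∈ Finset.range N, X n ω) ∂P = 0 := by
      simp only [star_sum, Finset.mul_sum]
      rw [integral_finsetSum _ fun n _ => hcross n N]
      exact Finset.sum_eq_zero fun n hn => horth n N (Finset.mem_range.mp hn)
    have hexp : ∀ ω, ‖∑ n ∈ Finset.range (N + 1), X n ω‖ ^ 2 =
        ‖∑ n ∈ Finset.range N, X n ω‖ ^ 2 + ‖X N ω‖ ^ 2 +
          2 * (X N ω * star (∑ n ∈ Finset.range N, X n ω)).re := by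
      intro ω
      rw [Finset.sum_range_succ, add_comm, ← Complex.normSq_eq_norm_sq, Complex.normSq_add,
        Complex.normSq_eq_norm_sq, Complex.normSq_eq_norm_sq, RCLike.star_def]
      ring
    simp only [hexp]
    have hre : ∫ ω, (X N ω * star (∑ n ∈ Finset.range N, X n ω)).re ∂P = 0 := by
      refine (integral_re hc).trans ?_
      rw [hc0, map_zero]
    have hcre : Integrable
        (fun ω => 2 * (X N ω * star (∑ n ∈ Finset.range N, X n ω)).re) P := hc.re.const_mul 2
    have hadd : ∫ ω, (‖∑ n ∈ Finset.range N, X n ω‖ ^ 2 + ‖X N ω‖ ^ 2 +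
        2 * (X N ω * star (∑ n ∈ Finset.range N, X n ω)).re) ∂P =
        ∫ ω, (‖∑ n ∈ Finset.range N, X n ω‖ ^ 2 + ‖X N ω‖ ^ 2) ∂P +
        ∫ ω, 2 * (X N ω * star (∑ n ∈ Finset.range N, X n ω)).re ∂P :=
      integral_add ((hint N).add (hXint N)) hcre
    rw [hadd, integral_add (hint N) (hXint N), integral_const_mul, hre]
    have hX : ∫ ω, ‖X N ω‖ ^ 2 ∂P ≤ C ^ 2 := by
      have : ∫ ω, ‖X N ω‖ ^ 2 ∂P ≤ ∫ _, C ^ 2 ∂P := by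
        refine integral_mono_ae (hXint N) (integrable_const _) ?_
        filter_upwards [hb N] with ω hω
        gcongr
      simpa using this
    push_cast
    linarith

/-- Along squares the second moment of the average is at most `C ^ 2 / m ^ 2`, which is summable. So
the squared averages are almost surely summable and tend to zero; boundedness fills the gaps between
squares. -/
theorem ae_tendsto_average_of_orthogonal (hm : ∀ n, AEStronglyMeasurable (X n) P)
    (hb : ∀ n, ∀ᵐ ω ∂P, ‖X n ω‖ ≤ C)
    (horth : ∀ i j, i < j → ∫ ω, X j ω * star (X i ω) ∂P = 0) :
    ∀ᵐ ω ∂P, Tendsto (fun N : ℕ => (1 / (N : ℂ)) * ∑ n ∈ Finset.range N, X n ω) atTop (𝓝 0) := by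
  set Y : ℕ → Ω → ℝ := fun m ω => (‖∑ n ∈ Finset.range (m ^ 2), X n ω‖ / (m : ℝ) ^ 2) ^ 2 with hY
  have hm2 : ∀ N, AEStronglyMeasurable (fun ω => ∑ n ∈ Finset.range N, X n ω) P := fun N =>
    Finset.aestronglyMeasurable_fun_sum _ fun n _ => hm n
  have hYm : ∀ m, AEStronglyMeasurable (Y m) P := fun m =>
    (((hm2 _).norm.aemeasurable.div_const _).pow_const 2).aestronglyMeasurable
  have hYint : ∀ m, Integrable (Y m) P := by
    intro m
    refine Integrable.of_bound (hYm m) ((((m ^ 2 : ℕ) : ℝ) * C / (m : ℝ) ^ 2) ^ 2) ?_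
    filter_upwards [ae_all_iff.mpr hb] with ω hω
    have := norm_sum_le_of_le (Finset.range (m ^ 2)) fun n _ => hω n
    rw [Finset.sum_const, Finset.card_range, nsmul_eq_mul] at this
    rw [Real.norm_of_nonneg (by positivity)]
    simp only [hY]
    gcongr
  have hYle : ∀ m, ∫ ω, Y m ω ∂P ≤ C ^ 2 * (1 / (m : ℝ) ^ 2) := by
    intro m
    have h1 := integral_norm_sq_sum_le_of_orthogonal hm hb horth (m ^ 2)
    simp only [hY, div_pow]
    rw [integral_div]
    rcases Nat.eq_zero_or_pos m with rfl | h
    · simp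
    · have : (0 : ℝ) < m := by exact_mod_cast h
      rw [div_le_iff₀ (by positivity)]
      refine h1.trans (le_of_eq ?_)
      push_cast
      field_simp
  have hsum : ∑' m, ∫⁻ ω, ENNReal.ofReal (Y m ω) ∂P ≠ ⊤ := by
    have hs : Summable fun m : ℕ => C ^ 2 * (1 / (m : ℝ) ^ 2) :=
      (Real.summable_one_div_nat_pow.mpr one_lt_two).mul_left _
    refine ne_top_of_le_ne_top hs.tsum_ofReal_ne_top (ENNReal.tsum_le_tsum fun m => ?_)
    rw [← ofReal_integral_eq_lintegral_ofReal (hYint m)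
      (Eventually.of_forall fun ω => by positivity)]
    exact ENNReal.ofReal_le_ofReal (hYle m)
  rw [← lintegral_tsum fun m => (hYm m).aemeasurable.ennreal_ofReal] at hsum
  have hfin := ae_lt_top' (AEMeasurable.tsum fun m =>
    (hYm m).aemeasurable.ennreal_ofReal) hsum
  filter_upwards [hfin, ae_all_iff.mpr hb] with ω hω hbω
  refine tendsto_average_of_tendsto_average_sq hbω ?_
  have h1 := ENNReal.tendsto_atTop_zero_of_tsum_ne_top hω.ne
  have h2 := (ENNReal.tendsto_toReal ENNReal.zero_ne_top).comp h1
  have h3 : Tendsto (fun m => Y m ω) atTop (𝓝 0) := by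
    refine h2.congr fun m => ?_
    exact ENNReal.toReal_ofReal (by positivity)
  have h4 := (Real.continuous_sqrt.tendsto 0).comp h3
  rw [Real.sqrt_zero] at h4
  refine h4.congr fun m => ?_
  exact Real.sqrt_sq (by positivity)

end Orthogonal

/-! ### Factorization over past and present. -/

/-- Independence of the next variable from quantities that depend on the previous ones only. -/
theorem ProbabilityTheory.iIndepFun.integral_mul_of_past {Ω α : Type*} [MeasurableSpace Ω]
    {P : Measure Ω} [IsProbabilityMeasure P] [MeasurableSpace α] [Inhabited α] {β : ℕ → Ω → α}
    (hindep : iIndepFun β P) (hβ : ∀ n, AEMeasurable (β n) P) (j : ℕ) {g : α → ℂ}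
    (hg : Measurable g) {F : (ℕ → α) → ℂ} (hF : Measurable F)
    (hdep : ∀ b b' : ℕ → α, (∀ i < j, b i = b' i) → F b = F b') :
    ∫ ω, g (β j ω) * F (fun n => β n ω) ∂P =
      (∫ ω, g (β j ω) ∂P) * ∫ ω, F (fun n => β n ω) ∂P := by
  -- Extends a finite past to a full sequence. The default value is invisible to `F`, which by
  -- `hdep` reads only indices below `j`.
  set e : (Finset.range j → α) → ℕ → α :=
    fun b n => if h : n ∈ Finset.range j then b ⟨n, h⟩ else default with he
  have hem : Measurable e := by
    refine measurable_pi_iff.mpr fun n => ?_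
    by_cases h : n ∈ Finset.range j
    · simpa only [he, h, dite_true] using measurable_pi_apply _
    · simp only [he, h, dite_false]; exact measurable_const
  have hFe : ∀ ω, F (fun n => β n ω) = F (e fun i : Finset.range j => β i ω) := by
    refine fun ω => hdep _ _ fun i hi => ?_
    simp [he, hi]
  have hI := hindep.indepFun_finset₀ {j} (Finset.range j) (by simp) hβ
  simp only [hFe]
  have hg' : Measurable fun b : ({j} : Finset ℕ) → α => g (b ⟨j, by simp⟩) :=
    hg.comp (measurable_pi_apply _)
  have hF' : Measurable fun b => F (e b) := hF.comp hem
  exact hI.integral_fun_comp_mul_comp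
    (aemeasurable_pi_iff.mpr fun i => hβ i) (aemeasurable_pi_iff.mpr fun i => hβ i)
    hg'.aestronglyMeasurable hF'.aestronglyMeasurable

/-! ### Mean environment state -/

theorem Matrix.measurable_iff {α m n : Type*} [MeasurableSpace α] {f : α → Matrix m n ℂ} :
    Measurable f ↔ ∀ i j, Measurable fun a => f a i j :=
  measurable_pi_iff.trans (forall_congr' fun _ => measurable_pi_iff)

theorem Matrix.measurable_apply {m n : Type*} (i : m) (j : n) :
    Measurable fun M : Matrix m n ℂ => M i j :=
  Matrix.measurable_iff.mp measurable_id i j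

section Mean

variable {Ω : Type*} [MeasurableSpace Ω] {P : Measure Ω} {d' : ℕ}
  {β : Ω → Matrix (Fin d') (Fin d') ℂ}

theorem linearMap_expectedMatrix (f : Matrix (Fin d') (Fin d') ℂ →ₗ[ℂ] ℂ)
    (hint : ∀ i j, Integrable (fun ω => β ω i j) P) :
    Integrable (fun ω => f (β ω)) P ∧ ∫ ω, f (β ω) ∂P = f (expectedMatrix P β) := by
  have h : ∀ ω, f (β ω) = ∑ i, ∑ j, β ω i j • f (Matrix.single i j 1) :=
    fun ω => Matrix.linearMap_apply_eq_sum f (β ω)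
  simp only [h, smul_eq_mul]
  have hi : ∀ i, Integrable (fun ω => ∑ j, β ω i j * f (Matrix.single i j 1)) P := fun i =>
    integrable_finsetSum _ fun j _ => (hint i j).mul_const _
  refine ⟨integrable_finsetSum _ fun i _ => hi i, ?_⟩
  rw [integral_finsetSum _ fun i _ => hi i, Matrix.linearMap_apply_eq_sum f]
  refine Finset.sum_congr rfl fun i _ => ?_
  rw [integral_finsetSum _ fun j _ => (hint i j).mul_const _]
  refine Finset.sum_congr rfl fun j _ => ?_
  rw [integral_mul_const, smul_eq_mul]
  rfl

theorem ae_linearMap_eq_zero (f : Matrix (Fin d') (Fin d') ℂ →ₗ[ℂ] ℂ)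
    (hint : ∀ i j, Integrable (fun ω => β ω i j) P) (hf : ∀ᵐ ω ∂P, 0 ≤ f (β ω))
    (h0 : f (expectedMatrix P β) = 0) : ∀ᵐ ω ∂P, f (β ω) = 0 := by
  obtain ⟨h1, h2⟩ := linearMap_expectedMatrix f hint
  rw [h0] at h2
  have h3 : ∫ ω, (f (β ω)).re ∂P = 0 := by
    refine (integral_re h1).trans ?_
    rw [h2, map_zero]
  have h4 : 0 ≤ᵐ[P] fun ω => (f (β ω)).re := by
    filter_upwards [hf] with ω hω using (Complex.nonneg_iff.mp hω).1
  have h5 := (integral_eq_zero_iff_of_nonneg_ae h4 h1.re).mp h3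
  filter_upwards [h5, hf] with ω h h'
  exact Complex.ext h (Complex.nonneg_iff.mp h').2.symm

variable [IsProbabilityMeasure P]

theorem integrable_apply_of_isDensityMatrix (hm : AEMeasurable β P)
    (hdens : ∀ᵐ ω ∂P, IsDensityMatrix (β ω)) (i j : Fin d') : Integrable (fun ω => β ω i j) P := by
  refine Integrable.of_bound
    ((Matrix.measurable_apply i j).comp_aemeasurable hm).aestronglyMeasurable 1 ?_
  filter_upwards [hdens] with ω hω using hω.norm_apply_le_one i j

theorem isDensityMatrix_expectedMatrix (hint : ∀ i j, Integrable (fun ω => β ω i j) P)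
    (hdens : ∀ᵐ ω ∂P, IsDensityMatrix (β ω)) : IsDensityMatrix (expectedMatrix P β) := by
  refine ⟨Matrix.PosSemidef.of_dotProduct_mulVec_nonneg ?_ fun x => ?_, ?_⟩
  · ext i j
    change star (∫ ω, β ω j i ∂P) = ∫ ω, β ω i j ∂P
    rw [RCLike.star_def, ← integral_conj]
    refine integral_congr_ae ?_
    filter_upwards [hdens] with ω hω
    exact hω.1.isHermitian.apply i j
  · let f : Matrix (Fin d') (Fin d') ℂ →ₗ[ℂ] ℂ :=
      { toFun := fun M => star x ⬝ᵥ (M *ᵥ x)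
        map_add' := fun M N => by rw [Matrix.add_mulVec, dotProduct_add]
        map_smul' := fun c M => by rw [Matrix.smul_mulVec, dotProduct_smul]; rfl }
    obtain ⟨h1, h2⟩ := linearMap_expectedMatrix f hint
    change 0 ≤ f _
    have hf : ∀ᵐ ω ∂P, 0 ≤ f (β ω) := by
      filter_upwards [hdens] with ω hω using hω.1.dotProduct_mulVec_nonneg x
    rw [← h2, Complex.nonneg_iff]
    constructor
    · refine le_of_le_of_eq (integral_nonneg_of_ae ?_) (integral_re h1)
      filter_upwards [hf] with ω hω using (Complex.nonneg_iff.mp hω).1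
    · refine Eq.trans ?_ (integral_im h1)
      refine (integral_eq_zero_of_ae ?_).symm
      filter_upwards [hf] with ω hω using (Complex.nonneg_iff.mp hω).2.symm
  · obtain ⟨-, h2⟩ := linearMap_expectedMatrix (Matrix.traceLinearMap (Fin d') ℂ ℂ) hint
    rw [Matrix.traceLinearMap_apply] at h2
    rw [← h2]
    rw [integral_congr_ae (g := fun _ => (1 : ℂ))]
    · simp
    · filter_upwards [hdens] with ω hω using hω.2

/-- A second invariant state of the mean channel would supply two tests, linear in the environment
and nonnegative on states. Vanishing at the mean, they vanish almost surely, so uniqueness would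
fail almost surely. -/
theorem expectedMatrix_eq_of_isInvariantState {d : ℕ}
    (U : Matrix.unitaryGroup (Fin d × Fin d') ℂ)
    (hint : ∀ i j, Integrable (fun ω => β ω i j) P)
    (hdens : ∀ᵐ ω ∂P, IsDensityMatrix (β ω))
    (huniq : 0 < P {ω | ∃! ρ, IsInvariantState (interactionChannel U (β ω)) ρ})
    {θ σ : Matrix (Fin d) (Fin d) ℂ}
    (hθ : IsInvariantState (interactionChannel U (expectedMatrix P β)) θ)
    (hσ : IsInvariantState (interactionChannel U (expectedMatrix P β)) σ) : σ = θ := by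
  by_contra hne
  obtain ⟨A, B, R, Q, hA, hB, hR, hQ, hRA, hQB, htest⟩ :=
    ((isDensityMatrix_expectedMatrix hint hdens).isPositiveTracePreserving U).exists_tests_of_ne
      hσ hθ hne
  let f : Matrix (Fin d) (Fin d) ℂ → Matrix (Fin d) (Fin d) ℂ →
      Matrix (Fin d') (Fin d') ℂ →ₗ[ℂ] ℂ := fun R A =>
    Matrix.traceLinearMap (Fin d) ℂ ℂ ∘ₗ LinearMap.mulLeft ℂ R ∘ₗ interactionChannelEnv U A
  have key : ∀ R A : Matrix (Fin d) (Fin d) ℂ, R.PosSemidef → A.PosSemidef →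
      (R * interactionChannel U (expectedMatrix P β) A).trace = 0 →
      ∀ᵐ ω ∂P, (R * interactionChannel U (β ω) A).trace = 0 := by
    intro R A hR hA h0
    refine ae_linearMap_eq_zero (f R A) hint ?_ h0
    filter_upwards [hdens] with ω hω
    exact hR.trace_mul_nonneg (interactionChannel_posSemidef U hω.1 hA)
  refine huniq.ne' ?_
  have : ∀ᵐ ω ∂P, ¬ ∃! ρ, IsInvariantState (interactionChannel U (β ω)) ρ := by
    filter_upwards [hdens, key R A hR hA hRA, key Q B hQ hB hQB] with ω hω h1 h2
    exact htest _ (hω.isPositiveTracePreserving U) h1 h2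
  simpa [ae_iff] using this

end Mean

/-! ### Iterated states -/

section Iterated

variable {d d' : ℕ} (U : Matrix.unitaryGroup (Fin d × Fin d') ℂ)

theorem iteratedState_add (β : ℕ → Matrix (Fin d') (Fin d') ℂ) (X Y : Matrix (Fin d) (Fin d) ℂ)
    (n : ℕ) : iteratedState U β (X + Y) n = iteratedState U β X n + iteratedState U β Y n := by
  induction n with
  | zero => rfl
  | succ n ih => simp only [iteratedState, ih, map_add]

theorem iteratedState_smul (β : ℕ → Matrix (Fin d') (Fin d') ℂ) (c : ℂ)
    (X : Matrix (Fin d) (Fin d) ℂ) (n : ℕ) :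
    iteratedState U β (c • X) n = c • iteratedState U β X n := by
  induction n with
  | zero => rfl
  | succ n ih => simp only [iteratedState, ih, map_smul]

theorem iteratedState_congr {β γ : ℕ → Matrix (Fin d') (Fin d') ℂ}
    (X : Matrix (Fin d) (Fin d) ℂ) {n : ℕ} (h : ∀ i < n, β i = γ i) :
    iteratedState U β X n = iteratedState U γ X n := by
  induction n with
  | zero => rfl
  | succ n ih =>
    simp only [iteratedState]
    rw [ih fun i hi => h i (hi.trans n.lt_succ_self), h n n.lt_succ_self]

theorem iteratedState_posSemidef_trace {β : ℕ → Matrix (Fin d') (Fin d') ℂ}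
    (hβ : ∀ n, IsDensityMatrix (β n)) {X : Matrix (Fin d) (Fin d) ℂ} (hX : X.PosSemidef) (n : ℕ) :
    (iteratedState U β X n).PosSemidef ∧ (iteratedState U β X n).trace = X.trace := by
  induction n with
  | zero => exact ⟨hX, rfl⟩
  | succ n ih =>
    have h := (hβ n).isPositiveTracePreserving U
    exact ⟨h.posSemidef _ ih.1, (h.trace _).trans ih.2⟩

theorem interactionChannel_apply_eq_sum_sum (β : Matrix (Fin d') (Fin d') ℂ)
    (X : Matrix (Fin d) (Fin d) ℂ) (a b : Fin d) :
    interactionChannel U β X a b = ∑ k, ∑ l, β k l * ∑ i, ∑ j, X i j *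
      interactionChannel U (Matrix.single k l 1) (Matrix.single i j 1) a b := by
  rw [interactionChannel_apply_eq_sum]
  refine Finset.sum_congr rfl fun k _ => Finset.sum_congr rfl fun l _ => ?_
  rw [Matrix.linearMap_apply_eq_sum (interactionChannel U (Matrix.single k l 1)) X]
  simp only [Matrix.sum_apply, Matrix.smul_apply, smul_eq_mul]

theorem Measurable.interactionChannel {α : Type*} [MeasurableSpace α]
    {f : α → Matrix (Fin d') (Fin d') ℂ} {g : α → Matrix (Fin d) (Fin d) ℂ}
    (hf : Measurable f) (hg : Measurable g) :
    Measurable fun x => interactionChannel U (f x) (g x) := by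
  rw [Matrix.measurable_iff] at hf hg ⊢
  intro a b
  rw [funext fun x => interactionChannel_apply_eq_sum_sum U (f x) (g x) a b]
  fun_prop

theorem measurable_iteratedState (X : Matrix (Fin d) (Fin d) ℂ) (n : ℕ) :
    Measurable fun β : ℕ → Matrix (Fin d') (Fin d') ℂ => iteratedState U β X n := by
  induction n with
  | zero => exact measurable_const
  | succ n ih => exact Measurable.interactionChannel U (measurable_pi_apply n) ih

/-- The deviation of the `n`-th step of the evolution from the channel with environment `γ`. -/
def stepDeviation (γ : Matrix (Fin d') (Fin d') ℂ) (β : ℕ → Matrix (Fin d') (Fin d') ℂ)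
    (X : Matrix (Fin d) (Fin d) ℂ) (n : ℕ) : Matrix (Fin d) (Fin d) ℂ :=
  iteratedState U β X (n + 1) - interactionChannel U γ (iteratedState U β X n)

variable (γ : Matrix (Fin d') (Fin d') ℂ)

/-- Separates the increment `β n - γ`, centered when `γ` is the mean, from a factor depending on the
environments before `n` only. -/
theorem stepDeviation_apply (β : ℕ → Matrix (Fin d') (Fin d') ℂ) (X : Matrix (Fin d) (Fin d) ℂ)
    (n : ℕ) (a b : Fin d) :
    stepDeviation U γ β X n a b = ∑ k, ∑ l, (β n k l - γ k l) *
      interactionChannel U (Matrix.single k l 1) (iteratedState U β X n) a b := by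
  simp only [stepDeviation, iteratedState, Matrix.sub_apply]
  rw [interactionChannel_apply_eq_sum U (β n), interactionChannel_apply_eq_sum U γ]
  simp only [← Finset.sum_sub_distrib, ← sub_mul]

theorem measurable_stepDeviation (X : Matrix (Fin d) (Fin d) ℂ) (n : ℕ) (a b : Fin d) :
    Measurable fun β : ℕ → Matrix (Fin d') (Fin d') ℂ => stepDeviation U γ β X n a b :=
  (Matrix.measurable_iff.mp (measurable_iteratedState U X (n + 1)) a b).sub
    (Matrix.measurable_iff.mp
      (Measurable.interactionChannel U measurable_const (measurable_iteratedState U X n)) a b)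

theorem norm_stepDeviation_apply_le (hγ : IsDensityMatrix γ)
    {β : ℕ → Matrix (Fin d') (Fin d') ℂ} (hβ : ∀ n, IsDensityMatrix (β n))
    {X : Matrix (Fin d) (Fin d) ℂ} (hX : X.PosSemidef) (n : ℕ) (a b : Fin d) :
    ‖stepDeviation U γ β X n a b‖ ≤ X.trace.re + X.trace.re := by
  have h1 := iteratedState_posSemidef_trace U hβ hX (n + 1)
  have h2 := iteratedState_posSemidef_trace U hβ hX n
  have h3 := hγ.isPositiveTracePreserving U
  have h4 := h1.1.norm_apply_le_trace a b
  have h5 := (h3.posSemidef _ h2.1).norm_apply_le_trace a b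
  rw [h1.2] at h4
  rw [h3.trace, h2.2] at h5
  exact (norm_sub_le _ _).trans (add_le_add h4 h5)

theorem stepDeviation_add (β : ℕ → Matrix (Fin d') (Fin d') ℂ) (X Y : Matrix (Fin d) (Fin d) ℂ)
    (n : ℕ) : stepDeviation U γ β (X + Y) n = stepDeviation U γ β X n + stepDeviation U γ β Y n := by
  simp only [stepDeviation, iteratedState_add, map_add]
  abel

theorem stepDeviation_smul (β : ℕ → Matrix (Fin d') (Fin d') ℂ) (c : ℂ)
    (X : Matrix (Fin d) (Fin d) ℂ) (n : ℕ) :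
    stepDeviation U γ β (c • X) n = c • stepDeviation U γ β X n := by
  simp only [stepDeviation, iteratedState_smul, map_smul, smul_sub]

/-- The initial matrices whose step deviations average to zero. -/
def negligibleDeviations (β : ℕ → Matrix (Fin d') (Fin d') ℂ) :
    Submodule ℂ (Matrix (Fin d) (Fin d) ℂ) where
  carrier := {X | Tendsto (fun N : ℕ => (1 / (N : ℂ)) •
    ∑ n ∈ Finset.Icc 1 N, stepDeviation U γ β X n) atTop (𝓝 0)}
  add_mem' {X Y} hX hY := by
    have := Tendsto.add hX hY
    simpa only [Set.mem_ofPred_eq, stepDeviation_add, Finset.sum_add_distrib, smul_add, add_zero]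
      using this
  zero_mem' := by
    have h : ∀ n, stepDeviation U γ β 0 n = 0 := fun n => by
      simpa using stepDeviation_smul U γ β 0 0 n
    simp [h]
  smul_mem' c X hX := by
    have := Tendsto.const_smul hX c
    rw [smul_zero] at this
    refine this.congr fun N => ?_
    simp only [stepDeviation_smul, ← Finset.smul_sum]
    rw [smul_comm]

/-- A submodule of matrices is everything if it contains finitely many well-chosen positive
semidefinite matrices. -/
theorem Matrix.submodule_eq_top_of_polarization {n : Type*} [Fintype n] [DecidableEq n]
    (W : Submodule ℂ (Matrix n n ℂ))
    (h : ∀ (i j : n) (t : Fin 4), (1 + Complex.I ^ (t : ℕ) • Matrix.single i j (1 : ℂ))ᴴ *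
      (1 + Complex.I ^ (t : ℕ) • Matrix.single i j (1 : ℂ)) ∈ W) : W = ⊤ := by
  refine eq_top_iff.mpr fun X _ => ?_
  rw [Matrix.matrix_eq_sum_single X]
  refine W.sum_mem fun i _ => W.sum_mem fun j _ => ?_
  -- Polarization of the pair `(1, M)`: the two differences are `2(M + Mᴴ)` and `2i(M - Mᴴ)`.
  have hpol : ∀ M : Matrix n n ℂ, ((1 + Complex.I ^ 0 • M)ᴴ * (1 + Complex.I ^ 0 • M)
      - (1 + Complex.I ^ 2 • M)ᴴ * (1 + Complex.I ^ 2 • M))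
      - Complex.I • ((1 + Complex.I ^ 1 • M)ᴴ * (1 + Complex.I ^ 1 • M)
      - (1 + Complex.I ^ 3 • M)ᴴ * (1 + Complex.I ^ 3 • M)) = (4 : ℂ) • M := by
    intro M
    simp only [Matrix.conjTranspose_add, Matrix.conjTranspose_smul, Matrix.conjTranspose_one,
      Matrix.add_mul, Matrix.mul_add, Matrix.one_mul, Matrix.mul_one, Matrix.smul_mul,
      Matrix.mul_smul, Complex.I_sq, Complex.I_pow_three, pow_zero, pow_one, star_one,
      star_neg, RCLike.star_def, Complex.conj_I]
    ext a b
    simp only [Matrix.sub_apply, Matrix.add_apply, Matrix.smul_apply, smul_eq_mul]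
    ring_nf
    simp only [Complex.I_sq]
    ring
  have h4 : (4 : ℂ) • Matrix.single i j (1 : ℂ) ∈ W := by
    rw [← hpol]
    exact W.sub_mem (W.sub_mem (h i j 0) (h i j 2)) (W.smul_mem _ (W.sub_mem (h i j 1) (h i j 3)))
  have h5 : Matrix.single i j (X i j) = (X i j / 4) • (4 : ℂ) • Matrix.single i j (1 : ℂ) := by
    rw [smul_smul, div_mul_cancel₀ _ (by norm_num), Matrix.smul_single, smul_eq_mul, mul_one]
  rw [h5]
  exact W.smul_mem _ h4

end Iterated

/-! ### Almost sure convergence -/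

section Convergence

variable {Ω : Type*} [MeasurableSpace Ω] {P : Measure Ω} [IsProbabilityMeasure P] {d d' : ℕ}
  (U : Matrix.unitaryGroup (Fin d × Fin d') ℂ) {β : ℕ → Ω → Matrix (Fin d') (Fin d') ℂ}

theorem integral_stepDeviation_mul_star (hdens : ∀ n, ∀ᵐ ω ∂P, IsDensityMatrix (β n ω))
    (hindep : iIndepFun β P) (hident : ∀ n, IdentDistrib (β n) (β 0) P P)
    {X : Matrix (Fin d) (Fin d) ℂ} (hX : X.PosSemidef) (a b : Fin d) {i j : ℕ} (hij : i < j) :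
    ∫ ω, stepDeviation U (expectedMatrix P (β 0)) (fun n => β n ω) X j a b *
      star (stepDeviation U (expectedMatrix P (β 0)) (fun n => β n ω) X i a b) ∂P = 0 := by
  set γ := expectedMatrix P (β 0) with hγ
  have hm : ∀ n, AEMeasurable (β n) P := fun n => (hident n).aemeasurable_fst
  have hmeas : AEMeasurable (fun ω n => β n ω) P := aemeasurable_pi_iff.mpr hm
  have hint : ∀ n k l, Integrable (fun ω => β n ω k l) P := fun n =>
    integrable_apply_of_isDensityMatrix (hm n) (hdens n)
  have hγd : IsDensityMatrix γ := isDensityMatrix_expectedMatrix (hint 0) (hdens 0)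
  -- Everything except the centered entry of `β j`. The deviation at step `i` involves the
  -- environments up to index `i`, all below `j`.
  let F : Fin d' → Fin d' → (ℕ → Matrix (Fin d') (Fin d') ℂ) → ℂ := fun k l c =>
    interactionChannel U (Matrix.single k l 1) (iteratedState U c X j) a b *
      star (stepDeviation U γ c X i a b)
  have hF : ∀ k l, Measurable (F k l) := fun k l =>
    (Matrix.measurable_iff.mp (Measurable.interactionChannel U measurable_const
      (measurable_iteratedState U X j)) a b).mul
      (continuous_star.measurable.comp (measurable_stepDeviation U γ X i a b))
  have hFdep : ∀ k l (c c' : ℕ → Matrix (Fin d') (Fin d') ℂ), (∀ n < j, c n = c' n) →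
      F k l c = F k l c' := by
    intro k l c c' h
    simp only [F, stepDeviation]
    rw [iteratedState_congr U X h, iteratedState_congr U X fun n hn => h n (by lia),
      iteratedState_congr U X fun n hn => h n (hn.trans hij)]
  have hFb : ∀ k l, ∃ K : ℝ, ∀ᵐ ω ∂P, ‖F k l (fun n => β n ω)‖ ≤ K := by
    intro k l
    refine ⟨(∑ p, ∑ q, X.trace.re * ‖interactionChannel U (Matrix.single k l 1)
      (Matrix.single p q 1) a b‖) * (X.trace.re + X.trace.re), ?_⟩
    filter_upwards [ae_all_iff.mpr hdens] with ω hω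
    have h1 := iteratedState_posSemidef_trace U hω hX j
    have h2 := norm_stepDeviation_apply_le U γ hγd hω hX i a b
    simp only [F]
    rw [norm_mul, norm_star]
    refine mul_le_mul ?_ h2 (norm_nonneg _) ?_
    · rw [Matrix.linearMap_apply_eq_sum (interactionChannel U (Matrix.single k l 1))]
      simp only [Matrix.sum_apply, Matrix.smul_apply, smul_eq_mul]
      refine norm_sum_le_of_le _ fun p _ => norm_sum_le_of_le _ fun q _ => ?_
      rw [norm_mul]
      refine mul_le_mul_of_nonneg_right ?_ (norm_nonneg _)
      rw [← h1.2]
      exact h1.1.norm_apply_le_trace p q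
    · have h0 : 0 ≤ X.trace.re := (Complex.nonneg_iff.mp hX.trace_nonneg).1
      positivity
  have hterm : ∀ k l, Integrable (fun ω => (β j ω k l - γ k l) * F k l (fun n => β n ω)) P := by
    intro k l
    obtain ⟨K, hK⟩ := hFb k l
    exact ((hint j k l).sub (integrable_const _)).mul_bdd
      ((hF k l).comp_aemeasurable hmeas).aestronglyMeasurable hK
  have hzero : ∀ k l, ∫ ω, (β j ω k l - γ k l) * F k l (fun n => β n ω) ∂P = 0 := by
    intro k l
    rw [hindep.integral_mul_of_past hm j (g := fun M => M k l - γ k l)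
      ((Matrix.measurable_apply k l).sub_const _) (hF k l) (hFdep k l)]
    have h1 : ∫ ω, β j ω k l ∂P = γ k l :=
      ((hident j).comp (Matrix.measurable_apply k l)).integral_eq
    rw [integral_sub (hint j k l) (integrable_const _), h1]
    simp
  have hexp : ∀ ω, stepDeviation U γ (fun n => β n ω) X j a b *
      star (stepDeviation U γ (fun n => β n ω) X i a b) =
      ∑ k, ∑ l, (β j ω k l - γ k l) * F k l (fun n => β n ω) := by
    intro ω
    rw [stepDeviation_apply U γ _ X j]
    simp only [Finset.sum_mul, F, mul_assoc]
  simp only [hexp]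
  rw [integral_finsetSum _ fun k _ => integrable_finsetSum _ fun l _ => hterm k l]
  refine Finset.sum_eq_zero fun k _ => ?_
  rw [integral_finsetSum _ fun l _ => hterm k l]
  exact Finset.sum_eq_zero fun l _ => hzero k l

theorem ae_mem_negligibleDeviations (hdens : ∀ n, ∀ᵐ ω ∂P, IsDensityMatrix (β n ω))
    (hindep : iIndepFun β P) (hident : ∀ n, IdentDistrib (β n) (β 0) P P)
    {X : Matrix (Fin d) (Fin d) ℂ} (hX : X.PosSemidef) :
    ∀ᵐ ω ∂P, X ∈ negligibleDeviations U (expectedMatrix P (β 0)) (fun n => β n ω) := by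
  have hm : ∀ n, AEMeasurable (β n) P := fun n => (hident n).aemeasurable_fst
  have hmeas : AEMeasurable (fun ω n => β n ω) P := aemeasurable_pi_iff.mpr hm
  have hγ : IsDensityMatrix (expectedMatrix P (β 0)) := isDensityMatrix_expectedMatrix
    (integrable_apply_of_isDensityMatrix (hm 0) (hdens 0)) (hdens 0)
  have key : ∀ a b, ∀ᵐ ω ∂P, Tendsto (fun N : ℕ => (1 / (N : ℂ)) * ∑ n ∈ Finset.range N,
      stepDeviation U (expectedMatrix P (β 0)) (fun n => β n ω) X (n + 1) a b) atTop (𝓝 0) := by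
    intro a b
    refine ae_tendsto_average_of_orthogonal
      (X := fun n ω => stepDeviation U (expectedMatrix P (β 0)) (fun n => β n ω) X (n + 1) a b)
      (C := X.trace.re + X.trace.re)
      (fun n => ((measurable_stepDeviation U _ X (n + 1) a b).comp_aemeasurable
        hmeas).aestronglyMeasurable) (fun n => ?_)
      (fun i j hij => integral_stepDeviation_mul_star U hdens hindep hident hX a b
        (Nat.succ_lt_succ hij))
    filter_upwards [ae_all_iff.mpr hdens] with ω hω
    exact norm_stepDeviation_apply_le U _ hγ hω hX (n + 1) a b
  filter_upwards [ae_all_iff.mpr fun a => ae_all_iff.mpr (key a)] with ω hω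
  refine tendsto_pi_nhds.mpr fun a => tendsto_pi_nhds.mpr fun b => (hω a b).congr fun N => ?_
  -- The strong law indexes from `0`, the Cesàro sums from `1`; hence the shifted deviations `n +
  -- 1`.
  rw [Finset.range_eq_Ico, Finset.sum_Ico_add' (fun n =>
    stepDeviation U (expectedMatrix P (β 0)) (fun n => β n ω) X n a b) 0 N 1, zero_add,
    Finset.Ico_add_one_right_eq_Icc, Matrix.smul_apply, Matrix.sum_apply, smul_eq_mul]

/-- The exceptional set depends on the initial matrix, but only finitely many positive semidefinite
ones are needed to span. This is what makes the limit simultaneous in `ρ₀`. -/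
theorem ae_negligibleDeviations_eq_top (hdens : ∀ n, ∀ᵐ ω ∂P, IsDensityMatrix (β n ω))
    (hindep : iIndepFun β P) (hident : ∀ n, IdentDistrib (β n) (β 0) P P) :
    ∀ᵐ ω ∂P, negligibleDeviations U (expectedMatrix P (β 0)) (fun n => β n ω) = ⊤ := by
  filter_upwards [ae_all_iff.mpr fun i : Fin d => ae_all_iff.mpr fun j : Fin d =>
    ae_all_iff.mpr fun t : Fin 4 => ae_mem_negligibleDeviations U hdens hindep hident
      (Matrix.posSemidef_conjTranspose_mul_self
        (1 + Complex.I ^ (t : ℕ) • Matrix.single i j (1 : ℂ)))] with ω hω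
  exact Matrix.submodule_eq_top_of_polarization _ hω

theorem tendsto_cesaroState {γ : Matrix (Fin d') (Fin d') ℂ}
    {b : ℕ → Matrix (Fin d') (Fin d') ℂ} (hb : ∀ n, IsDensityMatrix (b n))
    {θ : Matrix (Fin d) (Fin d) ℂ}
    (huniq : ∀ σ, IsInvariantState (interactionChannel U γ) σ → σ = θ)
    {ρ : Matrix (Fin d) (Fin d) ℂ} (hρ : IsDensityMatrix ρ)
    (hneg : ρ ∈ negligibleDeviations U γ b) :
    Tendsto (fun N : ℕ => cesaroState U b ρ N) atTop (𝓝 θ) := by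
  have hst : ∀ n, IsDensityMatrix (iteratedState U b ρ n) := fun n =>
    ⟨(iteratedState_posSemidef_trace U hb hρ.1 n).1,
      (iteratedState_posSemidef_trace U hb hρ.1 n).2.trans hρ.2⟩
  have hS := tendsto_map_cesaro_sub (interactionChannel U γ)
    (fun k => (hst k).norm_apply_le_one) hneg
  refine isCompact_setOf_isDensityMatrix.tendsto_nhds_of_unique_mapClusterPt
    ?_ fun σ hσ hcl => huniq σ ⟨hσ, LinearMap.apply_eq_of_mapClusterPt _ hcl hS⟩
  filter_upwards [eventually_ne_atTop 0] with N hN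
  exact IsDensityMatrix.cesaro hst hN

end Convergence

/-! ### Maximally mixed states and the main theorem. -/

theorem isDensityMatrix_maximallyMixed {d : ℕ} (hd : d ≠ 0) :
    IsDensityMatrix ((1 / (d : ℂ)) • (1 : Matrix (Fin d) (Fin d) ℂ)) := by
  refine ⟨Matrix.PosSemidef.one.smul (by positivity), ?_⟩
  rw [Matrix.trace_smul, Matrix.trace_one, Fintype.card_fin, smul_eq_mul]
  exact one_div_mul_cancel (by exact_mod_cast hd)

theorem IsDensityMatrix.dim_ne_zero {d : ℕ} {ρ : Matrix (Fin d) (Fin d) ℂ}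
    (hρ : IsDensityMatrix ρ) : d ≠ 0 := by
  rintro rfl
  simpa [Matrix.trace] using hρ.2

theorem mainTheorem3 {Ω : Type*} [MeasurableSpace Ω] (P : Measure Ω) [IsProbabilityMeasure P]
    (d d' : ℕ) (U : Matrix.unitaryGroup (Fin d × Fin d') ℂ)
    (β : ℕ → Ω → Matrix (Fin d') (Fin d') ℂ)
    (hdens : ∀ n, ∀ᵐ ω ∂P, IsDensityMatrix (β n ω))
    (hindep : iIndepFun β P)
    (hident : ∀ n, IdentDistrib (β n) (β 0) P P)
    (huniq : 0 < P {ω | ∃! ρ, IsInvariantState (interactionChannel U (β 0 ω)) ρ}) :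
    (∀ i j, Integrable (fun ω => β 0 ω i j) P) ∧
    IsDensityMatrix (expectedMatrix P (β 0)) ∧
    ∃ θ : Matrix (Fin d) (Fin d) ℂ,
      (IsInvariantState (interactionChannel U (expectedMatrix P (β 0))) θ ∧
        ∀ σ, IsInvariantState (interactionChannel U (expectedMatrix P (β 0))) σ → σ = θ) ∧
      (∀ᵐ ω ∂P, ∀ ρ₀ : Matrix (Fin d) (Fin d) ℂ, IsDensityMatrix ρ₀ →
        Tendsto (fun N : ℕ => cesaroState U (fun n => β n ω) ρ₀ N) atTop (𝓝 θ)) ∧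
      (expectedMatrix P (β 0) = (1 / (d' : ℂ)) • (1 : Matrix (Fin d') (Fin d') ℂ) →
        θ = (1 / (d : ℂ)) • (1 : Matrix (Fin d) (Fin d) ℂ)) := by

  have hm : AEMeasurable (β 0) P := (hident 0).aemeasurable_fst
  have hint := integrable_apply_of_isDensityMatrix hm (hdens 0)
  have hγ := isDensityMatrix_expectedMatrix hint (hdens 0)
  -- An event of positive probability is nonempty, so some `d × d` state exists.
  have hd : d ≠ 0 := by
    obtain ⟨ω, ρ, hρ, -⟩ := nonempty_of_measure_ne_zero huniq.ne'
    exact hρ.1.dim_ne_zero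
  -- With `p = 1` the face is the whole state space.
  obtain ⟨θ, hθ, -⟩ := (hγ.isPositiveTracePreserving U).exists_isInvariantState (p := 1)
    (fun Y _ _ => Matrix.one_mul _) (isDensityMatrix_maximallyMixed hd) (Matrix.one_mul _)
  have hunique : ∀ σ, IsInvariantState (interactionChannel U (expectedMatrix P (β 0))) σ → σ = θ :=
    fun σ hσ => expectedMatrix_eq_of_isInvariantState U hint (hdens 0) huniq hθ hσ
  refine ⟨hint, hγ, θ, ⟨hθ, hunique⟩, ?_, fun h => ?_⟩
  · filter_upwards [ae_all_iff.mpr hdens, ae_negligibleDeviations_eq_top U hdens hindep hident]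
      with ω hω htop ρ hρ
    exact tendsto_cesaroState U hω hunique hρ (htop ▸ Submodule.mem_top)
  · refine (hunique _ ⟨isDensityMatrix_maximallyMixed hd, ?_⟩).symm
    rw [h]
    exact interactionChannel_maximallyMixed U hγ.dim_ne_zero _
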